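/- **Setting.** Let $P$ be a probability distribution on $\mathcal X\times\{\pm1\}$ with marginal $P_X$, and let $\mathcal F$ be a class of measurable functions $\mathcal X\to\{\pm1\}$ of finite VC dimension $d$. Let $R(f)=\Pr_{(x,y)\sim P}[f(x)\ne y]$, and let $\hat R(f,S)$ be the fraction of errors of $f$ on a finite sample $S$. Let $f^*\in\mathcal F$ be a minimizer of $R$ over $\mathcal F$. For $G\subseteq\mathcal F$ let $DIS(G)$ be the set of $x$ on which two members of $G$ differ, and $AGR(G)$ its complement. Put $B(f,r)=\{f'\in\mathcal F:\Pr_{P_X}[f'\ne f]\le r\}$ and $$\theta_f(r_0)=\sup_{r>r_0}\frac{P_X\big(DIS(B(f,r))\big)}{r}.$$ **Active-ILESS** (confidence $\delta$). For $m,\delta>0$ put $a(m,\delta)=\frac{4d}{m}\ln\frac{16me}{d\delta}$ (and $a=0$ if $d=0$) and $s(m,\delta,\rho)=a(m,\delta)+\sqrt{a(m,\delta)\,\rho}$, where the square root of a negative number is read as $0$. Start with $\hat S=\emptyset$ and $G_0=\mathcal F$. At step $t=1,2,\dots$ an example $x_t$ is received, where $(x_1,y_1),(x_2,y_2),\dots$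 are i.i.d. from $P$. If $G_{t-1}\neq\emptyset$ and $x_t\in AGR(G_{t-1})$, no label is requested and $x_t$ gets the common label given to it by the members of $G_{t-1}$; otherwise the label $y_t$ is requested. Add $x_t$ with this label to $\hat S$. If $t$ is a power of $2$ (including $t=1$), let $\hat f$ minimize $\hat R(\cdot,\hat S)$ over $\mathcal F$, let $\rho=\hat R(\hat f,\hat S)$, $$\sigma=s\big(\tfrac t2,\tfrac\delta{2t},\rho\big)+s\Big(\tfrac t2,\tfrac\delta{2t},\rho+s\big(\tfrac t2,\tfrac\delta{2t},\rho\big)\Big),$$ set $G_t=\{f\in\mathcal F:\hat R(f,\hat S)\le\rho+\sigma\}$ and reset $\hat S=\emptyset$. Otherwise set $G_t=G_{t-1}$. **Polylogarithmic functions.** $\mathrm{polylog}_1(x)$ is a function that for $x\ge1$ is nonnegative, nondecreasing and at most $C(1+\ln x)^k$ for some constants $C,k$. $\mathrm{polylog}_2(m,d,u)$ is a function that for $m,u\ge1$ is nonnegative, nondecreasing in $m$ and in $u$, and at most $C(1+\ln m+\ln(1+d)+\ln u)^k$ for some constants $C,k$. **Corollary 2.** Suppose that the events that Active-ILESS requests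 the label of the $t$-th example are measurable, and that for every integer $m\ge1$ and every $\delta\in(0,1)$, with probability at least $1-\delta$, the number of labels requested by Active-ILESS with confidence $\delta$ during the first $m$ examples is at most $$\mathrm{polylog}_1\Big(\frac1{R(f^*)+1/m}\Big)\cdot R(f^*)\,m+\mathrm{polylog}_2(m,d,1/\delta).$$ Then for every $r\in(0,1]$ with $r\ge R(f^*)$, $$\theta_{f^*}(r)\le 8\left(2\Big(\sqrt{\ln(2/r)}+\sqrt{\ln(2/r)+2\,\mathrm{polylog}_2(2/r,d,2/r)}\Big)^2+8\,\mathrm{polylog}_1(1/r)+2\right),$$ and for $r>1$ trivially $\theta_{f^*}(r)\le1$. For fixed $d$, the right-hand side is a polylogarithmic function of $1/r$ in the above sense, with constants that depend only on $\mathrm{polylog}_1$, $\mathrm{polylog}_2$ and $d$; hence $\theta_{f^*}(r)=O(\mathrm{polylog}(1/r))$. -/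

import Mathlib

open MeasureTheory

namespace ActiveILESS

noncomputable section

/-! Binary labels are modelled by `Bool`; a labelled example is an element of `X × Bool`. -/

/-- True zero-one error `R(f)` under the distribution `P` of labelled examples. -/
def trueRisk {X : Type*} [MeasurableSpace X] (P : Measure (X × Bool)) (f : X → Bool) : ℝ :=
  P.real {z | f z.1 ≠ z.2}

/-- Empirical zero-one error of `f` on a finite (multi)sample. -/
def empRisk {X : Type*} (f : X → Bool) (S : List (X × Bool)) : ℝ :=
  (S.countP (fun z => f z.1 != z.2) : ℝ) / (S.length : ℝ)

/-- `f` is a true risk minimizer in `F`. -/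
def IsTrueRiskMinimizer {X : Type*} [MeasurableSpace X] (P : Measure (X × Bool))
    (F : Set (X → Bool)) (f : X → Bool) : Prop :=
  f ∈ F ∧ ∀ f' ∈ F, trueRisk P f ≤ trueRisk P f'

/-- `f` is an empirical risk minimizer in `F` on the sample `S`. -/
def IsERM {X : Type*} (F : Set (X → Bool)) (S : List (X × Bool)) (f : X → Bool) : Prop :=
  f ∈ F ∧ ∀ f' ∈ F, empRisk f S ≤ empRisk f' S

/-- The class `F` shatters the finite set `A`. -/
def Shatters {X : Type*} (F : Set (X → Bool)) (A : Finset X) : Prop :=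
  ∀ g : X → Bool, ∃ f ∈ F, ∀ x ∈ A, f x = g x

/-- The class `F` has (finite) VC dimension `d`. -/
def HasVCDim {X : Type*} (F : Set (X → Bool)) (d : ℕ) : Prop :=
  IsGreatest {n : ℕ | ∃ A : Finset X, A.card = n ∧ Shatters F A} d

/-- Disagreement set. -/
def DIS {X : Type*} (G : Set (X → Bool)) : Set X :=
  {x | ∃ f₁ ∈ G, ∃ f₂ ∈ G, f₁ x ≠ f₂ x}

/-- Agreement set. -/
def AGR {X : Type*} (G : Set (X → Bool)) : Set X :=
  {x | ∀ f₁ ∈ G, ∀ f₂ ∈ G, f₁ x = f₂ x}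

/-- The ball `B(f, r)` in `F`, for the pseudo-metric `Pr (f' X ≠ f X)` under the marginal of `P`. -/
def ball {X : Type*} [MeasurableSpace X] (P : Measure (X × Bool)) (F : Set (X → Bool))
    (f : X → Bool) (r : ℝ) : Set (X → Bool) :=
  {f' ∈ F | P.fst.real {x | f' x ≠ f x} ≤ r}

/-- Disagreement coefficient `θ_f(r₀) = sup_{r > r₀} Δ B(f, r) / r`, with values in `[0, ∞]`. -/
def disCoeff {X : Type*} [MeasurableSpace X] (P : Measure (X × Bool)) (F : Set (X → Bool))
    (f : X → Bool) (r₀ : ℝ) : ENNReal :=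
  ⨆ (r : ℝ) (_ : r₀ < r), P.fst (DIS (ball P F f r)) / ENNReal.ofReal r

/-- The quantity `A / m`, where `A = 4 d ln (16 m e / (d δ))`. -/
def slackBase (m δ : ℝ) (d : ℕ) : ℝ :=
  4 * d * Real.log (16 * m * Real.exp 1 / (d * δ)) / m

/-- The common form `A / m + √((A / m) ρ)` of the two slacks used by the algorithm: the empirical
slack for `R - R̂` (with `ρ` an empirical error) and the non-empirical slack for `R̂ - R`
(with `ρ` in the place of a true error). -/
def slack (m δ : ℝ) (d : ℕ) (ρ : ℝ) : ℝ :=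
  slackBase m δ d + √(slackBase m δ d * ρ)

/-- The radius `σ_Active` at step `t`, when the empirical risk minimizer has empirical error `ρ`. -/
def sigmaActive (t : ℕ) (δ : ℝ) (d : ℕ) (ρ : ℝ) : ℝ :=
  slack ((t : ℝ) / 2) (δ / (2 * t)) d ρ +
    slack ((t : ℝ) / 2) (δ / (2 * t)) d (ρ + slack ((t : ℝ) / 2) (δ / (2 * t)) d ρ)

/-- The empirical low-error set around an empirical risk minimizer on `S`, of radius `σ_Active`.
It is the same for every choice of the minimizer. -/
def lowErrorSet {X : Type*} (F : Set (X → Bool)) (d : ℕ) (δ : ℝ) (t : ℕ) (S : List (X × Bool)) :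
    Set (X → Bool) :=
  {f ∈ F | ∃ fhat, IsERM F S fhat ∧
    empRisk f S ≤ empRisk fhat S + sigmaActive t δ d (empRisk fhat S)}

/-- State of Active-ILESS: the current low-error set and the current sample `Ŝ`. -/
structure State (X : Type*) where
  G : Set (X → Bool)
  S : List (X × Bool)

/-- With current low-error set `G`, the label of `x` is inferred if the hypotheses in `G` (of which
there is at least one) agree on `x`. Otherwise it is requested. -/
def Inferred {X : Type*} (G : Set (X → Bool)) (x : X) : Prop :=
  G.Nonempty ∧ x ∈ AGR G

open Classical in
/-- The label that the algorithm attaches to the example `z`: the common label of the hypotheses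
in `G` if it is inferred, and the true label (which is then requested) otherwise. -/
def assignedLabel {X : Type*} (G : Set (X → Bool)) (z : X × Bool) : Bool :=
  if h : Inferred G z.1 then h.1.some z.1 else z.2

open Classical in
/-- Step `t` (`t = 1, 2, …`) of Active-ILESS, on the example `z`. -/
def step {X : Type*} (F : Set (X → Bool)) (d : ℕ) (δ : ℝ) (t : ℕ) (s : State X) (z : X × Bool) :
    State X :=
  let S' := (z.1, assignedLabel s.G z) :: s.S
  if ∃ i : ℕ, t = 2 ^ i then ⟨lowErrorSet F d δ t S', []⟩ else ⟨s.G, S'⟩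

/-- State of Active-ILESS after the first `t` examples of the stream; the `t`-th example
is `ω (t - 1)`. -/
def run {X : Type*} (F : Set (X → Bool)) (d : ℕ) (δ : ℝ) (ω : ℕ → X × Bool) : ℕ → State X
  | 0 => ⟨F, []⟩
  | t + 1 => step F d δ (t + 1) (run F d δ ω t) (ω t)

/-- Active-ILESS requests the label of the example `ω i`. -/
def Requests {X : Type*} (F : Set (X → Bool)) (d : ℕ) (δ : ℝ) (ω : ℕ → X × Bool) (i : ℕ) : Prop :=
  ¬ Inferred (run F d δ ω i).G (ω i).1

open Classical in
/-- Number of labels that Active-ILESS requests among the first `m` examples. -/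
def numLabels {X : Type*} (F : Set (X → Bool)) (d : ℕ) (δ : ℝ) (ω : ℕ → X × Bool) (m : ℕ) : ℕ :=
  ((Finset.range m).filter (fun i => Requests F d δ ω i)).card

/-- Law of an i.i.d. stream of labelled examples. -/
def streamLaw {X : Type*} [MeasurableSpace X] (P : Measure (X × Bool)) [IsProbabilityMeasure P] :
    Measure (ℕ → X × Bool) :=
  Measure.infinitePi (fun _ : ℕ => P)

/-- `p(x) = polylog(x)`: nonnegative, nondecreasing and at most a power of the logarithm, for
`x ≥ 1`. -/
def IsPolylog (p : ℝ → ℝ) : Prop :=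
  (∀ x, 1 ≤ x → 0 ≤ p x) ∧ MonotoneOn p (Set.Ici 1) ∧
    ∃ (C : ℝ) (k : ℕ), ∀ x, 1 ≤ x → p x ≤ C * (1 + Real.log x) ^ k

/-- `p(m, d, u) = polylog(m, d, u)`: nonnegative, nondecreasing in `m` and `u` and at most a power
of the logarithms, for `m, u ≥ 1`. -/
def IsPolylog₃ (p : ℝ → ℕ → ℝ → ℝ) : Prop :=
  (∀ m d u, 1 ≤ m → 1 ≤ u → 0 ≤ p m d u) ∧
    (∀ m m' d u u', 1 ≤ m → 1 ≤ u → m ≤ m' → u ≤ u' → p m d u ≤ p m' d u') ∧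
    ∃ (C : ℝ) (k : ℕ), ∀ m d u, 1 ≤ m → 1 ≤ u →
      p m d u ≤ C * (1 + Real.log m + Real.log (1 + d) + Real.log u) ^ k

/-- The explicit bound on the disagreement coefficient. -/
def coeffBound (p₁ : ℝ → ℝ) (p₂ : ℝ → ℕ → ℝ → ℝ) (d : ℕ) (r : ℝ) : ℝ :=
  8 * (2 * (√(Real.log (2 / r)) + √(Real.log (2 / r) + 2 * p₂ (2 / r) d (2 / r))) ^ 2
    + 8 * p₁ (1 / r) + 2)

end

end ActiveILESS

open MeasureTheory

namespace ActiveILESS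

/-! ### Behaviour of the algorithm on data consistent with a hypothesis -/

/-! A label-efficient algorithm must have a small disagreement region, because it cannot tell apart
hypotheses that have made no error yet. Let `f` be the risk minimizer, `r ≥ R(f)` and `g` in the
ball of radius `r`. Then `R(f) + R(g) ≤ 3r`, so with probability at least 1/2 both are consistent
with the first `i ≤ 1/(6r)` examples. On that event each low-error set is empty or contains both
(`run_consistent`), so a next instance on which they differ has its label requested.

Every point of the disagreement region of the ball has such a `g`. Since the next example is
independent of the past, the request probability at time `i` is at least half the mass `Δ` of the
region (`fst_DIS_ball_le`). Summing over `m = ⌊1/(6r)⌋` examples gives at least `mΔ/2` expected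
requests. The assumed label bound with `δ = r/2` caps this expectation
(`sum_measureReal_le_of_card_le`), and dividing by `m`, of order `1/r`, bounds `Δ/r`. -/

theorem empRisk_nonneg {X : Type*} (f : X → Bool) (S : List (X × Bool)) : 0 ≤ empRisk f S := by
  unfold empRisk
  positivity

theorem empRisk_eq_zero {X : Type*} {f : X → Bool} {S : List (X × Bool)}
    (h : ∀ z ∈ S, f z.1 = z.2) : empRisk f S = 0 := by
  have hc : S.countP (fun z => f z.1 != z.2) = 0 := by
    rw [List.countP_eq_zero]
    intro z hz
    simp [h z hz]
  simp [empRisk, hc]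

/-- A low-error set on a sample on which `f` makes no error is empty (when its radius is negative)
or contains `f`. -/
theorem lowErrorSet_eq_empty_or_mem {X : Type*} {F : Set (X → Bool)} {f : X → Bool} (hf : f ∈ F)
    {S : List (X × Bool)} (h : ∀ z ∈ S, f z.1 = z.2) (d : ℕ) (δ : ℝ) (t : ℕ) :
    lowErrorSet F d δ t S = ∅ ∨ f ∈ lowErrorSet F d δ t S := by
  rcases Set.eq_empty_or_nonempty (lowErrorSet F d δ t S) with h0 | ⟨g, -, fhat, hfhat, hle⟩
  · exact Or.inl h0
  · refine Or.inr ⟨hf, fhat, hfhat, ?_⟩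
    -- The minimal empirical error is 0, and the member `g` shows that the radius is nonnegative.
    have h1 := hfhat.2 f hf
    have h2 := empRisk_nonneg fhat S
    have h3 := empRisk_nonneg g S
    rw [empRisk_eq_zero h] at h1 ⊢
    linarith

/-- An inferred label comes from a nonempty `G`, which then contains `f`, so the common label is
that of `f`; a requested label is the true one. -/
theorem eq_assignedLabel {X : Type*} {G : Set (X → Bool)} {f : X → Bool} {z : X × Bool}
    (hG : G = ∅ ∨ f ∈ G) (hz : f z.1 = z.2) : f z.1 = assignedLabel G z := by
  unfold assignedLabel
  split_ifs with h
  · rcases hG with hG | hG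
    · exact absurd h.1 (by simp [hG])
    · exact h.2 _ hG _ h.1.some_mem
  · exact hz

/-- As long as `f` makes no error on the stream, it makes no error on the current sample of the
algorithm, and the current low-error set is empty or contains `f`. -/
theorem run_consistent {X : Type*} {F : Set (X → Bool)} {f : X → Bool} (hf : f ∈ F) (d : ℕ) (δ : ℝ)
    (ω : ℕ → X × Bool) (n : ℕ) (h : ∀ j < n, f (ω j).1 = (ω j).2) :
    ((run F d δ ω n).G = ∅ ∨ f ∈ (run F d δ ω n).G) ∧
      ∀ z ∈ (run F d δ ω n).S, f z.1 = z.2 := by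
  induction n with
  | zero => exact ⟨Or.inr hf, by simp [run]⟩
  | succ n ih =>
    obtain ⟨hG, hS⟩ := ih fun j hj => h j (hj.trans n.lt_succ_self)
    have hS' : ∀ z ∈ ((ω n).1, assignedLabel (run F d δ ω n).G (ω n)) :: (run F d δ ω n).S,
        f z.1 = z.2 := by
      intro z hz
      rcases List.mem_cons.1 hz with rfl | hz
      · exact eq_assignedLabel hG (h n n.lt_succ_self)
      · exact hS z hz
    simp only [run, step]
    split_ifs
    · exact ⟨lowErrorSet_eq_empty_or_mem hf hS' _ _ _, by simp⟩
    · exact ⟨hG, hS'⟩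

/-- If two hypotheses are consistent with the stream so far and differ on the next example, then
the label of this example is requested. -/
theorem requests_of_consistent {X : Type*} {F : Set (X → Bool)} {f g : X → Bool}
    (hf : f ∈ F) (hg : g ∈ F) (d : ℕ) (δ : ℝ) (ω : ℕ → X × Bool) (n : ℕ)
    (hfω : ∀ j < n, f (ω j).1 = (ω j).2) (hgω : ∀ j < n, g (ω j).1 = (ω j).2)
    (hne : f (ω n).1 ≠ g (ω n).1) : Requests F d δ ω n := by
  rintro ⟨hne', hagr⟩
  rcases (run_consistent hf d δ ω n hfω).1 with h | h
  · exact hne'.ne_empty h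
  rcases (run_consistent hg d δ ω n hgω).1 with h' | h'
  · exact hne'.ne_empty h'
  exact hne (hagr _ h _ h')

/-! ### The i.i.d. stream -/

instance isProbabilityMeasure_streamLaw {X : Type*} [MeasurableSpace X] (P : Measure (X × Bool))
    [IsProbabilityMeasure P] : IsProbabilityMeasure (streamLaw P) := by
  unfold streamLaw
  infer_instance

/-- Resampling one coordinate preserves the law of an i.i.d. sequence. -/
theorem map_update_infinitePi {ι Y : Type*} [DecidableEq ι] [MeasurableSpace Y] (P : Measure Y)
    [IsProbabilityMeasure P] (i : ι) :
    ((Measure.infinitePi fun _ : ι => P).prod P).map (fun p => Function.update p.1 i p.2) =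
      Measure.infinitePi fun _ : ι => P := by
  refine Measure.eq_infinitePi _ fun s t ht => ?_
  rw [Measure.map_apply measurable_update' (.pi s.countable_toSet fun j _ => ht j)]
  by_cases hi : i ∈ s
  · have hpre : (fun p : (ι → Y) × Y => Function.update p.1 i p.2) ⁻¹' (s : Set ι).pi t =
        ((s.erase i : Finset ι) : Set ι).pi t ×ˢ t i := by
      ext ⟨ω, z⟩
      simp only [Set.mem_preimage, Set.mem_pi, Set.mem_prod, Finset.mem_coe, Finset.mem_erase]
      refine ⟨fun h => ⟨fun j hj => ?_, ?_⟩, fun h j hj => ?_⟩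
      · simpa [Function.update_of_ne hj.1] using h j hj.2
      · simpa using h i hi
      · rcases eq_or_ne j i with rfl | hji
        · simpa using h.2
        · simpa [Function.update_of_ne hji] using h.1 j ⟨hji, hj⟩
    rw [hpre, Measure.prod_prod, Measure.infinitePi_pi _ fun j _ => ht j,
      Finset.prod_erase_mul _ _ hi]
  · have hpre : (fun p : (ι → Y) × Y => Function.update p.1 i p.2) ⁻¹' (s : Set ι).pi t =
        (s : Set ι).pi t ×ˢ Set.univ := by
      ext ⟨ω, z⟩
      simp only [Set.mem_preimage, Set.mem_pi, Set.mem_prod, Finset.mem_coe, Set.mem_univ, and_true]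
      refine forall₂_congr fun j hj => ?_
      rw [Function.update_of_ne (by rintro rfl; exact hi hj)]
    rw [hpre, Measure.prod_prod, Measure.infinitePi_pi _ fun j _ => ht j, measure_univ, mul_one]

theorem measurableSet_error {X : Type*} [MeasurableSpace X] {f : X → Bool} (hf : Measurable f) :
    MeasurableSet {z : X × Bool | f z.1 ≠ z.2} :=
  (measurableSet_eq_fun (hf.comp measurable_fst) measurable_snd).compl

/-- Probability that `f` errs on one of the first `n` examples. -/
theorem streamLaw_exists_error_le {X : Type*} [MeasurableSpace X] (P : Measure (X × Bool))
    [IsProbabilityMeasure P] {f : X → Bool} (hf : Measurable f) (n : ℕ) :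
    (streamLaw P).real {ω | ∃ j < n, f (ω j).1 ≠ (ω j).2} ≤ n * trueRisk P f := by
  have hset : {ω : ℕ → X × Bool | ∃ j < n, f (ω j).1 ≠ (ω j).2} =
      ⋃ j ∈ Finset.range n, Function.eval j ⁻¹' {z : X × Bool | f z.1 ≠ z.2} := by
    ext ω
    simp
  rw [hset]
  refine (measureReal_biUnion_finset_le _ _).trans (le_of_eq ?_)
  have h : ∀ j ∈ Finset.range n,
      (streamLaw P).real (Function.eval j ⁻¹' {z : X × Bool | f z.1 ≠ z.2}) = trueRisk P f :=
    fun j _ => (measurePreserving_eval_infinitePi (fun _ : ℕ => P) j).measureReal_preimage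
      (measurableSet_error hf).nullMeasurableSet
  rw [Finset.sum_congr rfl h]
  simp

theorem trueRisk_le_add {X : Type*} [MeasurableSpace X] (P : Measure (X × Bool))
    [IsProbabilityMeasure P] {f g : X → Bool} (hf : Measurable f) (hg : Measurable g) :
    trueRisk P f ≤ trueRisk P g + P.fst.real {x | f x ≠ g x} := by
  have hm : MeasurableSet {x | f x ≠ g x} := (measurableSet_eq_fun hf hg).compl
  have hfst : P.fst.real {x | f x ≠ g x} = P.real (Prod.fst ⁻¹' {x | f x ≠ g x}) := by
    rw [measureReal_def, Measure.fst_apply hm, measureReal_def]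
  rw [hfst]
  refine (measureReal_mono ?_).trans (measureReal_union_le _ _)
  rintro ⟨x, y⟩ h
  by_cases hxy : g x = y
  · exact Or.inr (by simpa [hxy] using h)
  · exact Or.inl hxy

/-- Probability that two hypotheses are both consistent with the first `n` examples. -/
theorem le_streamLaw_consistent {X : Type*} [MeasurableSpace X] (P : Measure (X × Bool))
    [IsProbabilityMeasure P] {f g : X → Bool} (hf : Measurable f) (hg : Measurable g) (n : ℕ) :
    1 - n * (trueRisk P f + trueRisk P g) ≤
      (streamLaw P).real {ω | ∀ j < n, f (ω j).1 = (ω j).2 ∧ g (ω j).1 = (ω j).2} := by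
  have hcover : (Set.univ : Set (ℕ → X × Bool)) ⊆
      {ω | ∀ j < n, f (ω j).1 = (ω j).2 ∧ g (ω j).1 = (ω j).2} ∪
        ({ω | ∃ j < n, f (ω j).1 ≠ (ω j).2} ∪ {ω | ∃ j < n, g (ω j).1 ≠ (ω j).2}) := by
    intro ω _
    simp only [Set.mem_union, Set.mem_ofPred_eq]
    grind
  have h := measureReal_mono (μ := streamLaw P) hcover
  rw [probReal_univ] at h
  have h1 := measureReal_union_le (μ := streamLaw P)
    {ω | ∀ j < n, f (ω j).1 = (ω j).2 ∧ g (ω j).1 = (ω j).2}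
    ({ω | ∃ j < n, f (ω j).1 ≠ (ω j).2} ∪ {ω | ∃ j < n, g (ω j).1 ≠ (ω j).2})
  have h2 := measureReal_union_le (μ := streamLaw P)
    {ω | ∃ j < n, f (ω j).1 ≠ (ω j).2} {ω | ∃ j < n, g (ω j).1 ≠ (ω j).2}
  have h3 := streamLaw_exists_error_le P hf n
  have h4 := streamLaw_exists_error_le P hg n
  rw [mul_add]
  linarith

/-! ### Label requests and the disagreement region -/

/-- If an event of the stream has conditional probability at least `c` given any value of the
`i`-th example whose instance lies in `D`, then its probability is at least `c` times the (outer)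
measure of `D`. -/
theorem mul_fst_le_streamLaw {X : Type*} [MeasurableSpace X] (P : Measure (X × Bool))
    [IsProbabilityMeasure P] (A : Set (ℕ → X × Bool)) (i : ℕ) (D : Set X) (c : ENNReal)
    (h : ∀ z : X × Bool, z.1 ∈ D → c ≤ streamLaw P {ω | Function.update ω i z ∈ A}) :
    c * P.fst D ≤ streamLaw P A := by
  -- Neither `A` nor `D` need be measurable: `A` is replaced by a measurable hull, and `D` by the
  -- set of instances for which both labels satisfy the bound.
  set M := toMeasurable (streamLaw P) A with hM
  have hMm : MeasurableSet M := measurableSet_toMeasurable _ _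
  have hupd : Measurable fun p : (ℕ → X × Bool) × (X × Bool) => Function.update p.1 i p.2 :=
    measurable_update'
  set g : X × Bool → ENNReal := fun z => streamLaw P {ω | Function.update ω i z ∈ M} with hg
  have hgm : Measurable g := measurable_measure_prodMk_right (hupd hMm)
  have hDA : D ⊆ {x | c ≤ g (x, true)} ∩ {x | c ≤ g (x, false)} := by
    have hz : ∀ z : X × Bool, z.1 ∈ D → c ≤ g z := fun z hz =>
      (h z hz).trans (measure_mono fun ω hω => subset_toMeasurable _ _ hω)
    exact fun x hx => ⟨hz (x, true) hx, hz (x, false) hx⟩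
  have hAm : MeasurableSet ({x | c ≤ g (x, true)} ∩ {x | c ≤ g (x, false)}) :=
    (measurableSet_le measurable_const (hgm.comp (by fun_prop))).inter
      (measurableSet_le measurable_const (hgm.comp (by fun_prop)))
  calc c * P.fst D ≤ c * P {z | c ≤ g z} := by
        gcongr
        refine (measure_mono hDA).trans ?_
        rw [Measure.fst_apply hAm]
        refine measure_mono ?_
        rintro ⟨x, y⟩ ⟨h1, h2⟩
        cases y
        · exact h2
        · exact h1
    _ ≤ ∫⁻ z, g z ∂P := mul_meas_ge_le_lintegral hgm c
    _ = ((streamLaw P).prod P).map (fun p => Function.update p.1 i p.2) M := by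
        rw [Measure.map_apply hupd hMm, Measure.prod_apply_symm (hupd hMm)]
        rfl
    _ = streamLaw P A := by
        rw [streamLaw, map_update_infinitePi, ← streamLaw, hM, measure_toMeasurable]

/-- The measure of the disagreement region of a ball of radius `r ≥ R(f*)` is at most twice the
probability of requesting the label of any of the first `1 / (6 r)` examples. -/
theorem fst_DIS_ball_le {X : Type*} [MeasurableSpace X] (P : Measure (X × Bool))
    [IsProbabilityMeasure P] {F : Set (X → Bool)} (hF : ∀ f ∈ F, Measurable f)
    {f : X → Bool} (hf : f ∈ F) (d : ℕ) (δ : ℝ) {r : ℝ} (hr : trueRisk P f ≤ r) {i : ℕ}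
    (hi : 6 * r * i ≤ 1) :
    P.fst.real (DIS (ball P F f r)) ≤ 2 * (streamLaw P).real {ω | Requests F d δ ω i} := by
  have key : ENNReal.ofReal (1 / 2) * P.fst (DIS (ball P F f r)) ≤
      streamLaw P {ω | Requests F d δ ω i} := by
    refine mul_fst_le_streamLaw P _ i _ _ ?_
    rintro ⟨x, y⟩ ⟨f₁, hf₁, f₂, hf₂, hne⟩
    -- Of two hypotheses that differ at `x`, one differs from `f` there.
    obtain ⟨g, hg, hgx⟩ : ∃ g ∈ ball P F f r, f x ≠ g x := by
      by_cases h : f x = f₁ x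
      · exact ⟨f₂, hf₂, h ▸ hne⟩
      · exact ⟨f₁, hf₁, h⟩
    -- Consistency up to time `i` does not involve coordinate `i`, so it survives resampling it.
    have hsub : {ω : ℕ → X × Bool | ∀ j < i, f (ω j).1 = (ω j).2 ∧ g (ω j).1 = (ω j).2} ⊆
        {ω | Function.update ω i (x, y) ∈ {ω | Requests F d δ ω i}} := by
      intro ω hω
      refine requests_of_consistent hf hg.1 d δ _ i (fun j hj => ?_) (fun j hj => ?_) ?_
      · simpa [Function.update_of_ne hj.ne] using (hω j hj).1
      · simpa [Function.update_of_ne hj.ne] using (hω j hj).2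
      · simpa using hgx
    refine le_trans ?_ (measure_mono hsub)
    rw [← ofReal_measureReal]
    refine ENNReal.ofReal_le_ofReal (le_trans ?_ (le_streamLaw_consistent P (hF f hf)
      (hF g hg.1) i))
    -- `R(g) ≤ R(f) + r ≤ 2r`, so the failure probability is at most `3ri ≤ 1/2`.
    have h1 := trueRisk_le_add P (hF g hg.1) (hF f hf)
    have h2 := hg.2
    have h3 : (i : ℝ) * (trueRisk P f + trueRisk P g) ≤ i * (3 * r) := by
      gcongr
      linarith
    linarith
  have h := ENNReal.toReal_mono (measure_ne_top _ _) key
  rw [ENNReal.toReal_mul, ENNReal.toReal_ofReal (by norm_num)] at h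
  simp only [measureReal_def]
  linarith

/-! ### From a high-probability bound to a bound in expectation -/

open Classical in
-- The expected count is at most `K` from the good event plus `m` times the probability of its
-- complement.
theorem sum_measureReal_le_of_card_le {Ω : Type*} [MeasurableSpace Ω] (μ : Measure Ω)
    [IsProbabilityMeasure μ] (A : ℕ → Set Ω) (hA : ∀ i, NullMeasurableSet (A i) μ) (m : ℕ)
    {K δ : ℝ} (hK : 0 ≤ K)
    (h : 1 - δ ≤ μ.real {ω | (((Finset.range m).filter fun i => ω ∈ A i).card : ℝ) ≤ K}) :
    ∑ i ∈ Finset.range m, μ.real (A i) ≤ K + δ * m := by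
  have hN : ∀ ω, (((Finset.range m).filter fun i => ω ∈ A i).card : ℝ) =
      ∑ i ∈ Finset.range m, (A i).indicator (fun _ => (1 : ℝ)) ω := by
    intro ω
    rw [Finset.card_filter]
    push_cast
    rfl
  simp only [hN] at h
  have hind : ∀ s, NullMeasurableSet s μ → Integrable (s.indicator fun _ => (1 : ℝ)) μ :=
    fun s hs => (integrable_const 1).indicator₀ hs
  have hint : ∀ s, NullMeasurableSet s μ →
      ∫ ω, s.indicator (fun _ => (1 : ℝ)) ω ∂μ = μ.real s := by
    intro s hs
    rw [integral_indicator₀ hs]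
    simp
  have hsum : Integrable (fun ω => ∑ i ∈ Finset.range m, (A i).indicator (fun _ => (1 : ℝ)) ω) μ :=
    integrable_finsetSum _ fun i _ => hind _ (hA i)
  set B := {ω | ∑ i ∈ Finset.range m, (A i).indicator (fun _ => (1 : ℝ)) ω ≤ K} with hB
  have hBm : NullMeasurableSet B μ := nullMeasurableSet_le hsum.aemeasurable aemeasurable_const
  calc ∑ i ∈ Finset.range m, μ.real (A i)
      = ∫ ω, ∑ i ∈ Finset.range m, (A i).indicator (fun _ => (1 : ℝ)) ω ∂μ := by
        rw [integral_finsetSum _ fun i _ => hind _ (hA i)]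
        exact Finset.sum_congr rfl fun i _ => (hint _ (hA i)).symm
    _ ≤ ∫ ω, (K + m * Bᶜ.indicator (fun _ => (1 : ℝ)) ω) ∂μ := by
        refine integral_mono hsum ((integrable_const K).add ((hind _ hBm.compl).const_mul _)) ?_
        intro ω
        by_cases hω : ω ∈ B
        · have hle : ∑ i ∈ Finset.range m, (A i).indicator (fun _ => (1 : ℝ)) ω ≤ K := hω
          simpa only [Set.indicator_of_notMem (show ω ∉ Bᶜ from fun h => h hω), mul_zero, add_zero]
            using hle
        · have hm : ∑ i ∈ Finset.range m, (A i).indicator (fun _ => (1 : ℝ)) ω ≤ m := by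
            rw [← hN]
            exact_mod_cast (Finset.card_filter_le _ _).trans (by simp)
          simp only [Set.indicator_of_mem (show ω ∈ Bᶜ from hω)]
          linarith
    _ = K + m * μ.real Bᶜ := by
        rw [integral_add (integrable_const K) ((hind _ hBm.compl).const_mul _),
          integral_const_mul, hint _ hBm.compl]
        simp
    _ ≤ K + δ * m := by
        rw [probReal_compl_eq_one_sub₀ hBm, mul_comm δ]
        gcongr
        linarith

/-! ### The bound on the disagreement coefficient -/

/-- Only the second square root is kept: its square is at least `2 * p₂`. -/
theorem le_coeffBound {p₁ : ℝ → ℝ} {p₂ : ℝ → ℕ → ℝ → ℝ} (hp₂ : IsPolylog₃ p₂) (d : ℕ) {r : ℝ}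
    (hr : 0 < r) (hr1 : r ≤ 1) :
    32 * p₂ (2 / r) d (2 / r) + 64 * p₁ (1 / r) + 16 ≤ coeffBound p₁ p₂ d r := by
  have h2 : 1 ≤ 2 / r := by
    rw [le_div_iff₀ hr]
    linarith
  have hL : 0 ≤ Real.log (2 / r) := Real.log_nonneg h2
  have hp := hp₂.1 (2 / r) d (2 / r) h2 h2
  have hs1 := Real.sqrt_nonneg (Real.log (2 / r))
  have hs2 := Real.sqrt_nonneg (Real.log (2 / r) + 2 * p₂ (2 / r) d (2 / r))
  have hq := Real.sq_sqrt (show 0 ≤ Real.log (2 / r) + 2 * p₂ (2 / r) d (2 / r) by linarith)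
  unfold coeffBound
  nlinarith [mul_nonneg hs1 hs2, sq_nonneg (√(Real.log (2 / r)))]

theorem isPolylog_coeffBound {p₁ : ℝ → ℝ} (hp₁ : IsPolylog p₁) {p₂ : ℝ → ℕ → ℝ → ℝ}
    (hp₂ : IsPolylog₃ p₂) (d : ℕ) : IsPolylog (fun x => coeffBound p₁ p₂ d (1 / x)) := by
  have heq : ∀ x : ℝ, coeffBound p₁ p₂ d (1 / x) =
      8 * (2 * (√(Real.log (2 * x)) + √(Real.log (2 * x) + 2 * p₂ (2 * x) d (2 * x))) ^ 2
        + 8 * p₁ x + 2) := by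
    intro x
    simp [coeffBound]
  simp only [heq]
  refine ⟨fun x hx => ?_, fun x hx y hy hxy => ?_, ?_⟩
  · have := hp₁.1 x hx
    positivity
  · have hx : 1 ≤ x := hx
    have hy : 1 ≤ y := hy
    have h1 := hp₁.2.1 hx hy hxy
    have h2 : p₂ (2 * x) d (2 * x) ≤ p₂ (2 * y) d (2 * y) :=
      hp₂.2.1 _ _ _ _ _ (by linarith) (by linarith) (by linarith) (by linarith)
    have h3 : Real.log (2 * x) ≤ Real.log (2 * y) := Real.log_le_log (by linarith) (by linarith)
    dsimp only
    gcongr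
  · obtain ⟨C₁, k₁, h₁⟩ := hp₁.2.2
    obtain ⟨C₂, k₂, h₂⟩ := hp₂.2.2
    set D := Real.log (1 + d) with hD
    have hD0 : 0 ≤ D := Real.log_nonneg (by simp)
    -- The exponent dominates 1, `k₂` and `k₁`, so all terms compare with one power of `ℓ`; `(a +
    -- b)² ≤ 2(a² + b²)` removes the square roots.
    refine ⟨64 + 64 * (|C₂| * (3 + D) ^ k₂) + 64 * |C₁| + 16, 1 + k₂ + k₁, fun x hx => ?_⟩
    have hlog := Real.log_nonneg hx
    have hlog2 : Real.log (2 * x) = Real.log 2 + Real.log x :=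
      Real.log_mul (by norm_num) (by linarith)
    have hl2 : Real.log 2 < 1 := Real.log_two_lt_d9.trans (by norm_num)
    have hl20 : 0 < Real.log 2 := Real.log_pos (by norm_num)
    set ℓ := 1 + Real.log x with hℓ
    have hℓ1 : 1 ≤ ℓ := by linarith
    have hpow : ∀ k ≤ 1 + k₂ + k₁, ℓ ^ k ≤ ℓ ^ (1 + k₂ + k₁) :=
      fun k hk => pow_le_pow_right₀ hℓ1 hk
    have hb0 : 1 ≤ ℓ ^ (1 + k₂ + k₁) := one_le_pow₀ hℓ1
    have hb1 : Real.log (2 * x) ≤ ℓ ^ (1 + k₂ + k₁) := by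
      have := hpow 1 (by omega)
      rw [pow_one] at this
      linarith
    have hb2 : p₂ (2 * x) d (2 * x) ≤ |C₂| * (3 + D) ^ k₂ * ℓ ^ (1 + k₂ + k₁) := by
      have h2x : 1 ≤ 2 * x := by linarith
      have hbase : 0 ≤ 1 + Real.log (2 * x) + D + Real.log (2 * x) := by
        rw [hlog2]
        linarith
      calc p₂ (2 * x) d (2 * x)
          ≤ C₂ * (1 + Real.log (2 * x) + D + Real.log (2 * x)) ^ k₂ := h₂ _ d _ h2x h2x
        _ ≤ |C₂| * ((3 + D) * ℓ) ^ k₂ := by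
            gcongr
            · exact le_abs_self _
            · rw [hlog2]
              nlinarith [mul_nonneg hD0 hlog]
        _ = |C₂| * (3 + D) ^ k₂ * ℓ ^ k₂ := by rw [mul_pow, mul_assoc]
        _ ≤ |C₂| * (3 + D) ^ k₂ * ℓ ^ (1 + k₂ + k₁) :=
            mul_le_mul_of_nonneg_left (hpow k₂ (by omega)) (by positivity)
    have hb3 : p₁ x ≤ |C₁| * ℓ ^ (1 + k₂ + k₁) := by
      refine (h₁ x hx).trans ?_
      gcongr ?_ * ?_
      · exact le_abs_self _
      · exact hpow k₁ (by omega)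
    have hp0 := hp₂.1 (2 * x) d (2 * x) (by linarith) (by linarith)
    have hL0 : 0 ≤ Real.log (2 * x) := by linarith
    have hsq : (√(Real.log (2 * x)) + √(Real.log (2 * x) + 2 * p₂ (2 * x) d (2 * x))) ^ 2 ≤
        2 * (2 * Real.log (2 * x) + 2 * p₂ (2 * x) d (2 * x)) := by
      refine (add_sq_le).trans (le_of_eq ?_)
      rw [Real.sq_sqrt hL0, Real.sq_sqrt (by linarith)]
      ring
    linarith

theorem coeffBound_anti {p₁ : ℝ → ℝ} (hp₁ : IsPolylog p₁) {p₂ : ℝ → ℕ → ℝ → ℝ}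
    (hp₂ : IsPolylog₃ p₂) (d : ℕ) {r s : ℝ} (hr : 0 < r) (hrs : r ≤ s) (hs : s ≤ 1) :
    coeffBound p₁ p₂ d s ≤ coeffBound p₁ p₂ d r := by
  have hs0 : 0 < s := hr.trans_le hrs
  have h := (isPolylog_coeffBound hp₁ hp₂ d).2.1
    (show 1 / s ∈ Set.Ici 1 from one_le_one_div hs0 hs)
    (show 1 / r ∈ Set.Ici 1 from one_le_one_div hr (hrs.trans hs)) (one_div_le_one_div_of_le hr hrs)
  simpa using h

theorem sixteen_le_coeffBound {p₁ : ℝ → ℝ} (hp₁ : IsPolylog p₁) {p₂ : ℝ → ℕ → ℝ → ℝ}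
    (hp₂ : IsPolylog₃ p₂) (d : ℕ) {r : ℝ} (hr : 0 < r) (hr1 : r ≤ 1) :
    16 ≤ coeffBound p₁ p₂ d r := by
  have h2 : 1 ≤ 2 / r := by
    rw [le_div_iff₀ hr]
    linarith
  have h1 := hp₁.1 (1 / r) (one_le_one_div hr hr1)
  have h3 := hp₂.1 (2 / r) d (2 / r) h2 h2
  have h4 := le_coeffBound (p₁ := p₁) hp₂ d hr hr1
  linarith

/-- The disagreement mass of a ball of radius `r ≥ R(f*)`, given the label bound. -/
theorem fst_DIS_ball_le_mul_coeffBound {X : Type*} [MeasurableSpace X]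
    (P : Measure (X × Bool)) [IsProbabilityMeasure P]
    {F : Set (X → Bool)} (hF : ∀ f ∈ F, Measurable f) (d : ℕ) {f : X → Bool} (hf : f ∈ F)
    {p₁ : ℝ → ℝ} (hp₁ : IsPolylog p₁) {p₂ : ℝ → ℕ → ℝ → ℝ} (hp₂ : IsPolylog₃ p₂)
    (hmeas : ∀ δ : ℝ, 0 < δ → δ < 1 → ∀ i : ℕ,
      NullMeasurableSet {ω | Requests F d δ ω i} (streamLaw P))
    (hlabels : ∀ m : ℕ, 1 ≤ m → ∀ δ : ℝ, 0 < δ → δ < 1 →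
      1 - δ ≤ (streamLaw P).real {ω | (numLabels F d δ ω m : ℝ) ≤
        p₁ (1 / (trueRisk P f + 1 / m)) * trueRisk P f * m + p₂ m d (1 / δ)})
    {r : ℝ} (hr : 0 < r) (hr1 : r ≤ 1) (hrf : trueRisk P f ≤ r) :
    P.fst.real (DIS (ball P F f r)) ≤ coeffBound p₁ p₂ d r * r := by
  have h16 := sixteen_le_coeffBound hp₁ hp₂ d hr hr1
  -- For `r ≥ 1/16` the bound exceeds 1; otherwise `m ≥ 2`, which keeps the argument of `p₁` at
  -- least 1 and gives `1/(6r) < m + 1 ≤ 2m`.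
  rcases le_or_gt (1 / 16) r with hbig | hsmall
  · refine (measureReal_le_one (μ := P.fst)).trans ?_
    nlinarith
  have hR0 : 0 ≤ trueRisk P f := measureReal_nonneg
  set m := ⌊1 / (6 * r)⌋₊ with hm
  have hm_le : (m : ℝ) ≤ 1 / (6 * r) := Nat.floor_le (by positivity)
  have hm_gt : 1 / (6 * r) < m + 1 := Nat.lt_floor_add_one _
  have hm2 : 2 ≤ m := Nat.le_floor (by
    rw [le_div_iff₀ (by positivity)]
    push_cast
    linarith)
  have hm2' : (2 : ℝ) ≤ m := by exact_mod_cast hm2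
  have hmr : 6 * r * m ≤ 1 := by
    rw [le_div_iff₀ (by positivity)] at hm_le
    linarith
  have hmr' : 1 ≤ 12 * r * m := by
    rw [div_lt_iff₀ (by positivity)] at hm_gt
    nlinarith
  have hm_inv : (1 : ℝ) / m ≤ 1 / 2 := one_div_le_one_div_of_le (by norm_num) hm2'
  have hm_inv' : r ≤ 1 / m := by
    rw [le_div_iff₀ (by linarith)]
    nlinarith
  set q₁ := p₁ (1 / (trueRisk P f + 1 / m)) with hq₁
  set q₂ := p₂ m d (1 / (r / 2)) with hq₂
  have harg : 1 ≤ 1 / (trueRisk P f + 1 / m) := one_le_one_div (by linarith) (by linarith)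
  have hq₁0 : 0 ≤ q₁ := hp₁.1 _ harg
  have hq₁le : q₁ ≤ p₁ (1 / r) :=
    hp₁.2.1 harg (one_le_one_div hr hr1) (one_div_le_one_div_of_le hr (by linarith))
  have h2r : 1 / (r / 2) = 2 / r := one_div_div _ _
  have h2r1 : 1 ≤ 2 / r := by
    rw [le_div_iff₀ hr]
    linarith
  have hm2r : (m : ℝ) ≤ 2 / r := by
    rw [le_div_iff₀ hr]
    nlinarith
  have hq₂0 : 0 ≤ q₂ := hp₂.1 _ _ _ (by linarith) (h2r ▸ h2r1)
  have hq₂le : q₂ ≤ p₂ (2 / r) d (2 / r) := by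
    rw [hq₂, h2r]
    exact hp₂.2.1 _ _ _ _ _ (by linarith) h2r1 hm2r le_rfl
  have hδ0 : 0 < r / 2 := by linarith
  have hδ1 : r / 2 < 1 := by linarith
  -- With `δ = r/2` the failure event adds only `rm/2` to the expectation.
  have hsum := sum_measureReal_le_of_card_le (streamLaw P)
    (fun i => {ω | Requests F d (r / 2) ω i}) (hmeas _ hδ0 hδ1) m
    (K := q₁ * trueRisk P f * m + q₂) (by positivity)
    (hlabels m (by omega) (r / 2) hδ0 hδ1)
  have hlow : (m : ℝ) * (P.fst.real (DIS (ball P F f r)) / 2) ≤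
      ∑ i ∈ Finset.range m, (streamLaw P).real {ω | Requests F d (r / 2) ω i} := by
    have hconst : (m : ℝ) * (P.fst.real (DIS (ball P F f r)) / 2) =
        ∑ _i ∈ Finset.range m, P.fst.real (DIS (ball P F f r)) / 2 := by simp
    rw [hconst]
    refine Finset.sum_le_sum fun i hi => ?_
    have him : (i : ℝ) ≤ m := by exact_mod_cast (Finset.mem_range.1 hi).le
    have h := fst_DIS_ball_le P hF hf d (r / 2) hrf (i := i)
      ((mul_le_mul_of_nonneg_left him (by positivity)).trans hmr)
    linarith
  set Δ := P.fst.real (DIS (ball P F f r)) with hΔ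
  have hcb := le_coeffBound (p₁ := p₁) hp₂ d hr hr1
  have hmpos : (0 : ℝ) < m := by linarith
  have hp₁0 := hq₁0.trans hq₁le
  have hp₂0 := hq₂0.trans hq₂le
  have hA : q₁ * trueRisk P f * m ≤ p₁ (1 / r) * r * m := by gcongr
  -- The additive term is made proportional to `rm` through `1 ≤ 12rm`.
  have hB : q₂ ≤ p₂ (2 / r) d (2 / r) * (12 * r * m) :=
    hq₂le.trans (le_mul_of_one_le_right hp₂0 hmr')
  have hfin : m * Δ ≤ m * ((2 * p₁ (1 / r) + 24 * p₂ (2 / r) d (2 / r) + 1) * r) := by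
    linarith
  refine (le_of_mul_le_mul_left hfin hmpos).trans ?_
  gcongr
  linarith

end ActiveILESS

open MeasureTheory ActiveILESS in
theorem corollary2 {X : Type*} [MeasurableSpace X]
    (P : Measure (X × Bool)) [IsProbabilityMeasure P]
    (F : Set (X → Bool)) (hF : ∀ f ∈ F, Measurable f)
    (d : ℕ) (hd : HasVCDim F d)
    (fstar : X → Bool) (hfstar : IsTrueRiskMinimizer P F fstar)
    (p₁ : ℝ → ℝ) (hp₁ : IsPolylog p₁)
    (p₂ : ℝ → ℕ → ℝ → ℝ) (hp₂ : IsPolylog₃ p₂)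
    -- the label requests are random events
    (hmeas : ∀ δ : ℝ, 0 < δ → δ < 1 → ∀ i : ℕ,
      NullMeasurableSet {ω | Requests F d δ ω i} (streamLaw P))
    -- the label bound after `m` examples, with probability at least `1 - δ`
    (hlabels : ∀ m : ℕ, 1 ≤ m → ∀ δ : ℝ, 0 < δ → δ < 1 →
      1 - δ ≤ (streamLaw P).real {ω | (numLabels F d δ ω m : ℝ) ≤
        p₁ (1 / (trueRisk P fstar + 1 / m)) * trueRisk P fstar * m + p₂ m d (1 / δ)}) :
    (∀ r : ℝ, 0 < r → trueRisk P fstar ≤ r →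
      (r ≤ 1 → disCoeff P F fstar r ≤ ENNReal.ofReal (coeffBound p₁ p₂ d r)) ∧
      (1 < r → disCoeff P F fstar r ≤ 1)) ∧
    IsPolylog (fun x => coeffBound p₁ p₂ d (1 / x)) := by
  refine ⟨fun r hr hrf => ⟨fun hr1 => ?_, fun hr1 => ?_⟩, isPolylog_coeffBound hp₁ hp₂ d⟩
  · refine iSup₂_le fun s hs => ENNReal.div_le_of_le_mul ?_
    have hs0 : 0 < s := hr.trans hs
    have h16 := sixteen_le_coeffBound hp₁ hp₂ d hr hr1
    rw [← ENNReal.ofReal_mul (by linarith), ← ofReal_measureReal]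
    refine ENNReal.ofReal_le_ofReal ?_
    -- The supremum runs over `s > r`: for `s ≤ 1` the bound at `s` is at most that at `r`, and for
    -- `s > 1` the mass is at most `1 ≤ 16s`.
    rcases le_or_gt s 1 with hs1 | hs1
    · refine (fst_DIS_ball_le_mul_coeffBound P hF d hfstar.1 hp₁ hp₂ hmeas hlabels hs0 hs1
        (hrf.trans hs.le)).trans ?_
      exact mul_le_mul_of_nonneg_right (coeffBound_anti hp₁ hp₂ d hr hs.le hs1) hs0.le
    · refine (measureReal_le_one (μ := P.fst)).trans ?_
      nlinarith
  · refine iSup₂_le fun s hs => ENNReal.div_le_of_le_mul ?_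
    rw [one_mul]
    exact prob_le_one.trans (ENNReal.one_le_ofReal.2 (hr1.trans hs).le)
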